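/- Let $L$ be a finite-dimensional Lie algebra over a field $F$. For a subalgebra $U$ of $L$ let $R(U)$ denote its (solvable) radical, that is, the largest solvable ideal of $U$. Call $U$ \emph{solregular} if $F$ has characteristic zero, or if $F$ has characteristic $p>0$ and $R(U)$ has derived length less than $\log_2 p$. A \emph{subideal} of $L$ is a subalgebra $I$ for which there is a chain of subalgebras $I=I_0<I_1<\dots<I_n=L$ ($n\ge 0$) such that $I_j$ is an ideal of $I_{j+1}$ for each $0\le j\le n-1$. Then: (i) If $I$ is a solregular ideal of $L$, then $R(I)\subseteq R(L)$. (ii) If $I$ is a solregular subideal of $L$ and every subideal of $L$ containing $I$ is solregular, then $R(I)\subseteq R(L)$. -/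

import Mathlib

namespace ChiefFactors

variable {F : Type*} {L : Type*} [Field F] [LieRing L] [LieAlgebra F L]

/-- The subalgebra `I` is contained in the subalgebra `J` and is an ideal of it. -/
def IsIdealOf (I J : LieSubalgebra F L) : Prop :=
  I ≤ J ∧ ∀ x ∈ J, ∀ y ∈ I, ⁅x, y⁆ ∈ I

/-- `I` is a subideal of `L`: there is a finite strictly increasing chain of subalgebras
`I = I₀ < I₁ < ⋯ < Iₙ = L` in which every term is an ideal of the next one
(with `n = 0` for `I = L`). -/
def IsSubideal (I : LieSubalgebra F L) : Prop :=
  ∃ (n : ℕ) (c : Fin (n + 1) → LieSubalgebra F L),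
    StrictMono c ∧ c 0 = I ∧ c (Fin.last n) = ⊤ ∧
      ∀ j : Fin n, IsIdealOf (c j.castSucc) (c j.succ)

/-- The solvable radical `R(U)` of a subalgebra `U` of `L`, viewed as a subalgebra of `L`. -/
noncomputable def radicalIn (U : LieSubalgebra F L) : LieSubalgebra F L :=
  ((LieAlgebra.radical F U).toLieSubalgebra F U).map U.incl

/-- `U` is solregular: the field has characteristic zero, or it has prime characteristic `p`
and the solvable radical of `U` has derived length less than `log₂ p`. -/
def IsSolregular (U : LieSubalgebra F L) : Prop :=
  CharZero F ∨ ∃ p : ℕ, p.Prime ∧ CharP F p ∧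
    (LieAlgebra.derivedLength F (LieAlgebra.radical F U) : ℝ) < Real.logb 2 p

end ChiefFactors

namespace LieDerivation

open LieAlgebra

variable {F A : Type*} [Field F] [LieRing A] [LieAlgebra F A] (D : LieDerivation F A A)

/-! Everything reduces to showing that a derivation `D` preserves a radical `R` of derived length
`n` when `(2 ^ n)!` is invertible. By Leibniz, the `m`-th derived term of `R + D(R)` lies in `R +
D^(2^m)(R^(m))`; at `m = n` this is `R`, so `R + D(R)` is solvable and hence inside `R`.
Solregularity gives `2 ^ n < p`, hence invertibility. If `U` is an ideal of `V`, applying this to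
the maps `ad x` on `U` makes `R(U)` a solvable ideal of `V`, so `R(U) ⊆ R(V)`; climb the chain. -/

theorem iterate_smul (k : ℕ) (c : F) (x : A) : D^[k] (c • x) = c • D^[k] x :=
  (Function.Semiconj.iterate_right (f := (c • · : A → A))
    (fun x => (D.map_smul c x).symm) k x).symm

/-- An iterate of a derivation of order less than `2 ^ m` maps the `m`-th derived term of an ideal
into that ideal. -/
theorem iterate_mem_of_mem_derivedSeriesOfIdeal (R : LieIdeal F A) (m : ℕ) :
    ∀ k < 2 ^ m, ∀ x ∈ derivedSeriesOfIdeal F A m R, D^[k] x ∈ R := by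
  induction m with
  | zero =>
    intro k hk x hx
    obtain rfl : k = 0 := by simpa using hk
    simpa using hx
  | succ m ih =>
    intro k hk x hx
    rw [derivedSeriesOfIdeal_succ, ← LieSubmodule.mem_toSubmodule,
      LieSubmodule.lieIdeal_oper_eq_linear_span'] at hx
    induction hx using Submodule.span_induction with
    | mem x hx =>
      obtain ⟨a, ha, b, hb, rfl⟩ := hx
      rw [iterate_apply_lie]
      refine sum_mem fun ij hij => nsmul_mem ?_ _
      rw [Finset.HasAntidiagonal.mem_antidiagonal] at hij
      rw [pow_succ] at hk
      rcases lt_or_ge ij.1 (2 ^ m) with h | h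
      · exact lie_mem_left F A R _ _ (ih _ h _ ha)
      · exact lie_mem_right F A R _ _ (ih _ (by omega) _ hb)
    | zero => rw [iterate_map_zero]; exact R.zero_mem
    | add x y _ _ hx hy => rw [iterate_map_add]; exact R.add_mem hx hy
    | smul c x _ hx => rw [D.iterate_smul]; exact R.smul_mem c hx

/-- The ideal `R + D(R)`. -/
def supMap (R : LieIdeal F A) : LieIdeal F A where
  __ := R.toSubmodule ⊔ R.toSubmodule.map (D : A →ₗ[F] A)
  lie_mem := by
    intro x y hy
    obtain ⟨r, hr, _, ⟨s, hs, rfl⟩, rfl⟩ := Submodule.mem_sup.1 hy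
    have h : ⁅x, r + D s⁆ = (⁅x, r⁆ - ⁅D x, s⁆) + D ⁅x, s⁆ := by
      rw [apply_lie_eq_add, lie_add]; abel
    exact Submodule.mem_sup.2 ⟨_, sub_mem (R.lie_mem hr) (R.lie_mem hs), _,
      ⟨_, R.lie_mem hs, rfl⟩, h.symm⟩

theorem mem_supMap {R : LieIdeal F A} {y : A} :
    y ∈ D.supMap R ↔ ∃ r ∈ R, ∃ s ∈ R, r + D s = y := by
  change y ∈ R.toSubmodule ⊔ R.toSubmodule.map (D : A →ₗ[F] A) ↔ _
  simp [Submodule.mem_sup]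

/-- For `a, b` in `R^(m)`, each Leibniz term of `D^(2^(m+1)) ⁅a, b⁆` except the middle one
differentiates some factor fewer than `2 ^ m` times, so lies in `R`. Dividing by the middle binomial
coefficient expresses `⁅D^(2^m) a, D^(2^m) b⁆` modulo `R`. -/
theorem exists_of_mem_derivedSeriesOfIdeal_supMap (R : LieIdeal F A) (m : ℕ)
    (hm : ((2 ^ m).factorial : F) ≠ 0) :
    ∀ y ∈ derivedSeriesOfIdeal F A m (D.supMap R),
      ∃ r ∈ R, ∃ s ∈ derivedSeriesOfIdeal F A m R, r + D^[2 ^ m] s = y := by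
  induction m with
  | zero => intro y hy; simpa using D.mem_supMap.1 hy
  | succ m ih =>
    have hm' : ((2 ^ m).factorial : F) ≠ 0 := by
      obtain ⟨c, hc⟩ := Nat.factorial_dvd_factorial
        (Nat.pow_le_pow_right (n := 2) two_pos m.le_succ)
      rw [hc, Nat.cast_mul] at hm
      exact left_ne_zero_of_mul hm
    have hch : (((2 ^ (m + 1)).choose (2 ^ m) : ℕ) : F) ≠ 0 := by
      rw [← Nat.choose_mul_factorial_mul_factorial
        (Nat.pow_le_pow_right (n := 2) two_pos m.le_succ), Nat.cast_mul, Nat.cast_mul] at hm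
      exact left_ne_zero_of_mul (left_ne_zero_of_mul hm)
    intro y hy
    rw [derivedSeriesOfIdeal_succ, ← LieSubmodule.mem_toSubmodule,
      LieSubmodule.lieIdeal_oper_eq_linear_span'] at hy
    induction hy using Submodule.span_induction with
    | mem y hy =>
      obtain ⟨u, hu, v, hv, rfl⟩ := hy
      obtain ⟨r, hr, a, ha, rfl⟩ := ih hm' u hu
      obtain ⟨s, hs, b, hb, rfl⟩ := ih hm' v hv
      set c : F := (((2 ^ (m + 1)).choose (2 ^ m) : ℕ) : F)
      have hlead : D^[2 ^ (m + 1)] ⁅a, b⁆ - c • ⁅D^[2 ^ m] a, D^[2 ^ m] b⁆ ∈ R := by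
        have hmem : (2 ^ m, 2 ^ m) ∈ Finset.HasAntidiagonal.antidiagonal (2 ^ (m + 1)) := by
          rw [Finset.HasAntidiagonal.mem_antidiagonal]; ring
        rw [iterate_apply_lie, ← Finset.add_sum_erase _ _ hmem, Nat.cast_smul_eq_nsmul,
          add_sub_cancel_left]
        refine sum_mem fun ij hij => nsmul_mem ?_ _
        obtain ⟨hne, hij⟩ := Finset.mem_erase.1 hij
        rw [Finset.HasAntidiagonal.mem_antidiagonal, pow_succ] at hij
        rcases lt_or_ge ij.1 (2 ^ m) with h | h
        · exact lie_mem_left F A R _ _ (D.iterate_mem_of_mem_derivedSeriesOfIdeal R m _ h _ ha)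
        · refine lie_mem_right F A R _ _
            (D.iterate_mem_of_mem_derivedSeriesOfIdeal R m _ ?_ _ hb)
          -- Both orders at least `2 ^ m` would force the erased middle pair.
          by_contra h'
          exact hne (Prod.ext (by simp only; omega) (by simp only; omega))
      refine ⟨⁅r, s + D^[2 ^ m] b⁆ + ⁅D^[2 ^ m] a, s⁆ -
        c⁻¹ • (D^[2 ^ (m + 1)] ⁅a, b⁆ - c • ⁅D^[2 ^ m] a, D^[2 ^ m] b⁆), ?_,
        c⁻¹ • ⁅a, b⁆, ?_, ?_⟩
      · exact sub_mem (add_mem (lie_mem_left F A R _ _ hr) (lie_mem_right F A R _ _ hs))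
          (R.smul_mem _ hlead)
      · rw [derivedSeriesOfIdeal_succ]
        exact SMulMemClass.smul_mem _ (LieSubmodule.lie_mem_lie ha hb)
      · rw [D.iterate_smul, smul_sub, inv_smul_smul₀ hch]
        simp only [add_lie, lie_add]
        abel
    | zero => exact ⟨0, R.zero_mem, 0, LieSubmodule.zero_mem _, by simp [iterate_map_zero]⟩
    | add x y _ _ hx hy =>
      obtain ⟨r, hr, a, ha, rfl⟩ := hx
      obtain ⟨s, hs, b, hb, rfl⟩ := hy
      exact ⟨r + s, add_mem hr hs, a + b, add_mem ha hb, by rw [iterate_map_add]; abel⟩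
    | smul c x _ hx =>
      obtain ⟨r, hr, a, ha, rfl⟩ := hx
      refine ⟨c • r, R.smul_mem c hr, c • a, SMulMemClass.smul_mem c ha, ?_⟩
      rw [D.iterate_smul, smul_add]

/-- A derivation preserves the radical when `(2 ^ n)!` is invertible, `n` being the derived length
of the radical. -/
theorem apply_mem_radical [FiniteDimensional F A]
    (h : ((2 ^ derivedLength F (radical F A)).factorial : F) ≠ 0) {x : A}
    (hx : x ∈ radical F A) : D x ∈ radical F A := by
  set R := radical F A
  set n := derivedLength F R
  have hn : derivedSeriesOfIdeal F A n R = ⊥ := by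
    rw [← LieIdeal.derivedSeries_eq_bot_iff]
    exact Nat.sInf_mem (IsSolvable.solvable F R)
  have hle : derivedSeriesOfIdeal F A n (D.supMap R) ≤ R := by
    intro y hy
    obtain ⟨r, hr, s, hs, rfl⟩ := D.exists_of_mem_derivedSeriesOfIdeal_supMap R n h y hy
    rw [hn, LieSubmodule.mem_bot] at hs
    simpa [hs, iterate_map_zero] using hr
  have hsol : IsSolvable (D.supMap R) := by
    -- `n` steps to enter `R`, then `n` more to reach zero.
    refine IsSolvable.mk (R := F) (k := n + n) ?_
    rw [LieIdeal.derivedSeries_eq_bot_iff, derivedSeriesOfIdeal_add, eq_bot_iff, ← hn]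
    exact derivedSeriesOfIdeal_mono hle n
  exact (LieIdeal.solvable_iff_le_radical F A _).1 hsol
    (D.mem_supMap.2 ⟨0, R.zero_mem, x, hx, zero_add _⟩)

end LieDerivation

namespace ChiefFactors

variable {F : Type*} {L : Type*} [Field F] [LieRing L] [LieAlgebra F L]

theorem IsSolregular.factorial_ne_zero {U : LieSubalgebra F L} (h : IsSolregular U) :
    ((2 ^ LieAlgebra.derivedLength F (LieAlgebra.radical F U)).factorial : F) ≠ 0 := by
  rcases h with h | ⟨p, hp, hchar, hlt⟩
  · exact Nat.cast_ne_zero.2 (Nat.factorial_ne_zero _)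
  · rw [Ne, CharP.cast_eq_zero_iff F p, hp.dvd_factorial, not_le]
    rw [Real.lt_logb_iff_rpow_lt one_lt_two (by exact_mod_cast hp.pos), Real.rpow_natCast] at hlt
    exact_mod_cast hlt

/-- The derivation of an ideal `U` of `V` given by bracketing with an element of `V`. -/
def IsIdealOf.ad {U V : LieSubalgebra F L} (h : IsIdealOf U V) (x : V) : LieDerivation F U U where
  toFun y := ⟨⁅(x : L), (y : L)⁆, h.2 x x.2 y y.2⟩
  map_add' y z := Subtype.ext (lie_add _ _ _)
  map_smul' c y := Subtype.ext (lie_smul _ _ _)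
  leibniz' y z := Subtype.ext <| by
    simp only [LinearMap.coe_mk, AddHom.coe_mk, LieSubalgebra.coe_bracket,
      AddSubgroupClass.coe_sub]
    rw [leibniz_lie, ← lie_skew (z : L) ⁅(x : L), (y : L)⁆]
    abel

theorem mem_radicalIn {U : LieSubalgebra F L} {x : L} :
    x ∈ radicalIn U ↔ ∃ h : x ∈ U, (⟨x, h⟩ : U) ∈ LieAlgebra.radical F U := by
  constructor
  · rintro ⟨y, hy, rfl⟩
    exact ⟨y.2, hy⟩
  · rintro ⟨h, hx⟩
    exact ⟨⟨x, h⟩, hx, rfl⟩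

/-- The radical of a solregular ideal `U` of `V`, as an ideal of `V`. -/
noncomputable def IsIdealOf.radicalIdeal [FiniteDimensional F L] {U V : LieSubalgebra F L}
    (h : IsIdealOf U V) (hU : IsSolregular U) : LieIdeal F V where
  __ := (radicalIn U).toSubmodule.comap V.toSubmodule.subtype
  lie_mem := by
    intro x y hy
    obtain ⟨hyU, hyR⟩ := mem_radicalIn.1 hy
    exact mem_radicalIn.2 ⟨_, (h.ad x).apply_mem_radical hU.factorial_ne_zero hyR⟩

theorem IsIdealOf.radicalIn_le [FiniteDimensional F L] {U V : LieSubalgebra F L}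
    (h : IsIdealOf U V) (hU : IsSolregular U) : radicalIn U ≤ radicalIn V := by
  have hmem (x : h.radicalIdeal hU) : ∃ hx : (x : L) ∈ U, (⟨x, hx⟩ : U) ∈ LieAlgebra.radical F U :=
    mem_radicalIn.1 x.2
  let f : h.radicalIdeal hU →ₗ⁅F⁆ LieAlgebra.radical F U :=
    { toFun := fun x => ⟨⟨x, (hmem x).1⟩, (hmem x).2⟩
      map_add' := fun _ _ => rfl
      map_smul' := fun _ _ => rfl
      map_lie' := rfl }
  have hf : Function.Injective f := fun x y hxy =>
    Subtype.ext (Subtype.ext (congrArg (fun z : LieAlgebra.radical F U => ((z : U) : L)) hxy))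
  have hsol : LieAlgebra.IsSolvable (h.radicalIdeal hU) := hf.lieAlgebra_isSolvable
  intro x hx
  have hxV : x ∈ V := h.1 (mem_radicalIn.1 hx).1
  exact mem_radicalIn.2 ⟨hxV, (LieAlgebra.LieIdeal.solvable_iff_le_radical F V _).1 hsol
    (show (⟨x, hxV⟩ : V) ∈ h.radicalIdeal hU from hx)⟩

theorem radicalIn_top_le [FiniteDimensional F L] :
    radicalIn (⊤ : LieSubalgebra F L) ≤ (LieAlgebra.radical F L).toLieSubalgebra F L := by
  let e : (⊤ : LieSubalgebra F L) ≃ₗ⁅F⁆ L := LieSubalgebra.topEquiv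
  let K : LieIdeal F L := (LieAlgebra.radical F (⊤ : LieSubalgebra F L)).comap e.symm.toLieHom
  let f : K →ₗ⁅F⁆ LieAlgebra.radical F (⊤ : LieSubalgebra F L) :=
    { toFun := fun x => ⟨e.symm x, x.2⟩
      map_add' := fun _ _ => rfl
      map_smul' := fun _ _ => rfl
      map_lie' := rfl }
  have hf : Function.Injective f := fun x y hxy =>
    Subtype.ext (e.symm.injective (congrArg Subtype.val hxy))
  have hsol : LieAlgebra.IsSolvable K := hf.lieAlgebra_isSolvable
  intro x hx
  obtain ⟨_, hx⟩ := mem_radicalIn.1 hx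
  exact (LieAlgebra.LieIdeal.solvable_iff_le_radical F L K).1 hsol hx

theorem isSubideal_of_chain {n : ℕ} {c : Fin (n + 1) → LieSubalgebra F L} (hc : StrictMono c)
    (htop : c (Fin.last n) = ⊤) (hid : ∀ j : Fin n, IsIdealOf (c j.castSucc) (c j.succ))
    (i : Fin (n + 1)) : IsSubideal (c i) := by
  have hi := i.is_le
  refine ⟨n - i, fun j => c ⟨i + j, by omega⟩, fun j k hjk => hc ?_, ?_, ?_, fun j => ?_⟩
  · simpa using hjk
  · simp
  · rw [← htop]; exact congrArg c (Fin.ext (Nat.add_sub_cancel' hi))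
  · exact hid ⟨i + j, by omega⟩

end ChiefFactors

theorem theoremt {F : Type*} {L : Type*} [Field F] [LieRing L] [LieAlgebra F L]
    [FiniteDimensional F L] :
    (∀ I : LieIdeal F L, ChiefFactors.IsSolregular (I.toLieSubalgebra F L) →
      ChiefFactors.radicalIn (I.toLieSubalgebra F L) ≤
        (LieAlgebra.radical F L).toLieSubalgebra F L) ∧
    (∀ I : LieSubalgebra F L, ChiefFactors.IsSubideal I → ChiefFactors.IsSolregular I →
      (∀ J : LieSubalgebra F L, ChiefFactors.IsSubideal J → I ≤ J →
        ChiefFactors.IsSolregular J) →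
      ChiefFactors.radicalIn I ≤ (LieAlgebra.radical F L).toLieSubalgebra F L) := by
  refine ⟨fun I hI => ?_, ?_⟩
  · have h : ChiefFactors.IsIdealOf (I.toLieSubalgebra F L) ⊤ :=
      ⟨le_top, fun x _ y hy => I.lie_mem hy⟩
    exact (h.radicalIn_le hI).trans ChiefFactors.radicalIn_top_le
  · rintro _ ⟨n, c, hc, rfl, htop, hid⟩ - hsol
    have key : ∀ i : Fin (n + 1), ChiefFactors.radicalIn (c 0) ≤ ChiefFactors.radicalIn (c i) := by
      intro i
      induction i using Fin.induction with
      | zero => exact le_rfl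
      | succ j ih =>
        -- Only the smaller term of each link has to be solregular.
        exact ih.trans ((hid j).radicalIn_le (hsol _
          (ChiefFactors.isSubideal_of_chain hc htop hid _) (hc.monotone (Fin.zero_le _))))
    exact (htop ▸ key (Fin.last n)).trans ChiefFactors.radicalIn_top_le
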